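/- Let $\mathbb{H}^2=\{x+iy : y>0\}$ carry the hyperbolic metric $ds^2=(dx^2+dy^2)/y^2$, let $\Gamma$ be a group of isometries of $\mathbb{H}^2$ (possibly orientation reversing) acting properly discontinuously and freely, and let $S=\Gamma\backslash\mathbb{H}^2$ be the resulting complete hyperbolic surface, with covering map $p:\mathbb{H}^2\to S$. For $A\subseteq S$ put $$h^{\ast}(A)=\frac{\ell(\partial A)}{\mathrm{Area}(A)},\qquad \overline{h}(A)=\inf_{D}\, h^{\ast}(D),$$ where $\partial$ is the topological boundary in $S$, $\ell$ is length (one-dimensional Hausdorff measure), $\mathrm{Area}$ is hyperbolic area, and $D$ ranges over all subsets of $A$ with smooth boundary and $0<\mathrm{Area}(D)<\infty$. Here $D$ has smooth boundary if near each point of $\partial D$ there is a smooth function $f$ on $S$, vanishing at that point with non-zero differential there, such that $\{f<0\}\subseteq D\subseteq\{f\le 0\}$ near that point. A *horocusp neighborhood* in $S$ is a set $C\subseteq S$ such that (i) $C$ is a neighborhood of an end of $S$, that is, $C$ is connected, has compact boundary and is not relatively compact, and (ii) $C$ is covered by a horoball, that is, $C=p(B)$ for an (open or closed) horoball $B\subset\mathbb{H}^2$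 such that each $\gamma\in\Gamma$ satisfies $\gamma B=B$ or $\gamma B\cap B=\emptyset$. **Lemma.** Let $C$ be a horocusp neighborhood in $S$. Then $$\overline{h}(C)=h^{\ast}(C)=1.$$ -/

import Mathlib

open MeasureTheory UpperHalfPlane
open scoped ENNReal ContDiff Pointwise MatrixGroups Matrix.ProjGenLinGroup

noncomputable section

namespace Hyp

/-- The quotient surface `Γ \ ℍ` (with the quotient topology). Here `ℍ` is the upper half-plane with
the hyperbolic metric `(dx² + dy²) / y²`, and `PGL(2, ℝ)` is its full isometry group (orientation
reversing isometries included). When `Γ` acts properly discontinuously and freely, this is a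
complete hyperbolic surface with universal cover `ℍ`, and every complete hyperbolic surface arises
in this way. -/
abbrev Surface (Γ : Subgroup PGL(2, ℝ)) : Type := MulAction.orbitRel.Quotient Γ ℍ

/-- The universal covering map `ℍ → Γ \ ℍ`. -/
def proj (Γ : Subgroup PGL(2, ℝ)) (z : ℍ) : Surface Γ := Quotient.mk _ z

/-- The size in `Γ \ ℍ` induced by a `Γ`-invariant measure `μ` on `ℍ`: the least `μ`-size of a set
upstairs that projects onto a set containing `A`. Equivalently, it is the `μ`-size of the part of the
preimage of `A` that lies in a Borel set of representatives of the `Γ`-orbits, and the covering map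
preserves the size of each Borel set on which it is injective (see `descend_image`). -/
def descend (Γ : Subgroup PGL(2, ℝ)) (μ : Measure ℍ) (A : Set (Surface Γ)) : ℝ≥0∞ :=
  ⨅ (E : Set ℍ) (_ : A ⊆ proj Γ '' E), μ E

theorem proj_eq_iff {Γ : Subgroup PGL(2, ℝ)} {z w : ℍ} :
    proj Γ z = proj Γ w ↔ ∃ γ ∈ Γ, γ • w = z := by
  unfold proj
  rw [Quotient.eq]
  constructor
  · rintro ⟨γ, h⟩
    exact ⟨γ, γ.2, h⟩
  · rintro ⟨γ, hγ, h⟩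
    exact ⟨⟨γ, hγ⟩, h⟩

/-- The induced size agrees with the one upstairs on each Borel set that is mapped injectively. -/
theorem descend_image {Γ : Subgroup PGL(2, ℝ)} [Countable Γ] [MeasurableConstSMul Γ ℍ]
    {μ : Measure ℍ} [SMulInvariantMeasure Γ ℍ μ] {U : Set ℍ} (hU : MeasurableSet U)
    (hinj : Set.InjOn (proj Γ) U) : descend Γ μ (proj Γ '' U) = μ U := by
  refine le_antisymm (iInf_le_of_le U (iInf_le_of_le subset_rfl le_rfl)) (le_iInf₂ fun E hE => ?_)
  obtain ⟨e, he⟩ := exists_surjective_nat Γ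
  set E' := toMeasurable μ E
  set V : ℕ → Set ℍ := fun n => U ∩ (fun z => e n • z) ⁻¹' E'
  have hV : ∀ n, MeasurableSet (V n) := fun n =>
    hU.inter (measurable_const_smul (e n) (measurableSet_toMeasurable μ E))
  have hW : ∀ n, MeasurableSet (disjointed V n) := fun n => MeasurableSet.disjointed hV n
  have hWV : ∀ n, disjointed V n ⊆ V n := disjointed_subset V
  have hcover : U ⊆ ⋃ n, disjointed V n := by
    rw [iUnion_disjointed]
    intro u hu
    obtain ⟨z, hz, hzu⟩ := hE ⟨u, hu, rfl⟩
    obtain ⟨γ, hγ, rfl⟩ := proj_eq_iff.1 hzu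
    obtain ⟨n, hn⟩ := he ⟨γ, hγ⟩
    refine Set.mem_iUnion.2 ⟨n, hu, subset_toMeasurable μ E ?_⟩
    simpa [hn] using hz
  have hdisj : Pairwise (Function.onFun Disjoint fun n => e n • disjointed V n) := by
    intro m n hmn
    refine Set.disjoint_left.2 ?_
    rintro _ ⟨u, hu, rfl⟩ ⟨v, hv, hvu⟩
    have huv : u = v := by
      refine hinj (hWV m hu).1 (hWV n hv).1 ?_
      refine proj_eq_iff.2 ⟨((e m)⁻¹ * e n : Γ), SetLike.coe_mem _, ?_⟩
      have : ((e m)⁻¹ * e n) • v = u := by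
        rw [mul_smul, inv_smul_eq_iff]
        exact hvu
      exact this
    subst huv
    exact Set.disjoint_left.1 (disjoint_disjointed V hmn) hu hv
  calc μ U ≤ ∑' n, μ (disjointed V n) := (measure_mono hcover).trans (measure_iUnion_le _)
    _ = ∑' n, μ (e n • disjointed V n) := by simp only [measure_smul]
    _ = μ (⋃ n, e n • disjointed V n) :=
        (measure_iUnion hdisj fun n => (hW n).const_smul (e n)).symm
    _ ≤ μ E' := by
        refine measure_mono (Set.iUnion_subset fun n => ?_)
        rintro _ ⟨u, hu, rfl⟩
        exact (hWV n hu).2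
    _ = μ E := measure_toMeasurable E

/-- The area of a subset of `Γ \ ℍ`, induced by the hyperbolic area `dx dy / y²` of `ℍ`. -/
def area (Γ : Subgroup PGL(2, ℝ)) (A : Set (Surface Γ)) : ℝ≥0∞ := descend Γ volume A

/-- The length of a subset of `Γ \ ℍ`, induced by the one-dimensional Hausdorff measure of the
hyperbolic distance of `ℍ`. -/
def length (Γ : Subgroup PGL(2, ℝ)) (A : Set (Surface Γ)) : ℝ≥0∞ :=
  descend Γ (Measure.hausdorffMeasure 1) A

/-- The isoperimetric ratio `h*(A)`: length of the boundary of `A` over area of `A`. (It is meaningful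
when the area is positive and finite. In `ℝ≥0∞` a ratio equal to `1` forces both.) -/
def isoRatio (Γ : Subgroup PGL(2, ℝ)) (A : Set (Surface Γ)) : ℝ≥0∞ :=
  length Γ (frontier A) / area Γ A

/-- `D` is a smooth subdomain of `Γ \ ℍ`: near each point of its boundary, in the coordinate of the
universal cover, `D` lies on one side of a regular level set of a smooth function. The boundary curve
may or may not belong to `D`, so both closed and open domains with smooth boundary are included. -/
def HasSmoothBoundary (Γ : Subgroup PGL(2, ℝ)) (D : Set (Surface Γ)) : Prop :=
  ∀ z : ℍ, proj Γ z ∈ frontier D →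
    ∃ f : ℂ → ℝ, ContDiff ℝ ∞ f ∧ f z = 0 ∧ fderiv ℝ f z ≠ 0 ∧
      ∀ᶠ w : ℍ in nhds z, (f w < 0 → proj Γ w ∈ D) ∧ (proj Γ w ∈ D → f w ≤ 0)

/-- The isoperimetric constant `h̄(A)`: the infimum of the isoperimetric ratios of the smooth
subdomains of `A` (of positive finite area, so that the ratio is defined). -/
def isoConst (Γ : Subgroup PGL(2, ℝ)) (A : Set (Surface Γ)) : ℝ≥0∞ :=
  ⨅ (D : Set (Surface Γ)) (_ : D ⊆ A) (_ : HasSmoothBoundary Γ D)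
    (_ : area Γ D ≠ 0) (_ : area Γ D ≠ ⊤), isoRatio Γ D

/-- A horoball of `ℍ`, open or closed: the image under an isometry of the horoball `Im z > 1`, or
`Im z ≥ 1`, based at `∞`. -/
def IsHoroball (B : Set ℍ) : Prop :=
  ∃ g : PGL(2, ℝ), B = (fun z => g • z) '' {z : ℍ | 1 < z.im} ∨
    B = (fun z => g • z) '' {z : ℍ | 1 ≤ z.im}

/-- `C` is covered by the set `B` of `ℍ`: `C` is the image of `B`, and each deck transformation either
preserves `B` or moves it off itself, so that `C` is the quotient of `B` by its stabilizer. -/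
def IsCoveredBy (Γ : Subgroup PGL(2, ℝ)) (C : Set (Surface Γ)) (B : Set ℍ) : Prop :=
  proj Γ '' B = C ∧
    ∀ γ ∈ Γ, (((fun z => γ • z) '' B) ∩ B).Nonempty → (fun z => γ • z) '' B = B

/-- A neighborhood of an end of a surface: a connected set with compact boundary that is not
relatively compact. -/
def IsEndNeighborhood {S : Type*} [TopologicalSpace S] (C : Set S) : Prop :=
  IsConnected C ∧ IsCompact (frontier C) ∧ ¬ IsCompact (closure C)

/-- A horocusp neighborhood: a neighborhood of an end which is covered by a horoball. -/
def IsHorocuspNeighborhood (Γ : Subgroup PGL(2, ℝ)) (C : Set (Surface Γ)) : Prop :=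
  IsEndNeighborhood C ∧ ∃ B : Set ℍ, IsHoroball B ∧ IsCoveredBy Γ C B

end Hyp

end

/-! Move the horoball to `∞`, so that `C` is the image of `im z > 1` or `im z ≥ 1`. The engine is a
bound in `ℍ`: the region vertically above a set `F` has area at most the length of `F`, because
above a piece of width `dx` at height `y` lies area `dx / y`, while the piece has length at least
`dx / y` (`volume_shadow_le`).

Compactness of the boundary of `C` yields a nonzero translation among the deck transformations, and
proper discontinuity a least one, `t`. Modulo translations every point of the cusp lies in the
half-strip `0 ≤ re z < t`, `1 ≤ im z`, on which the covering map is injective off a countable set.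
Given `D ⊆ C`, descend vertically from a point of the lifted `D` to height `1`: the boundary is met
on the way, since no point at height `1` is interior to the lift. So the shadow of the boundary in
the half-strip covers `D`, and area is at most length (`area_le_length_frontier`).

For the horocusp at height `s ≥ 1` the area is `t / s` and the boundary has length at most `t / s`,
so its ratio is exactly `1`. With `s = 1` this is `C`; with `s = 2` the boundary is smooth and the
infimum is attained. -/

namespace UpperHalfPlane

/-! ### Isometries and area in `ℍ` -/

/-- The Euclidean distance scales by the square root of the product of the two factors by which the
heights scale, so these cancel in the `cosh` formula. -/
theorem dist_gl_smul (g : GL (Fin 2) ℝ) (z w : ℍ) : dist (g • z) (g • w) = dist z w := by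
  have h : dist ((g • z : ℍ) : ℂ) (g • w : ℍ) =
      |g.det.val| * dist (z : ℂ) w / (‖denom g z‖ * ‖denom g w‖) := by
    rw [coe_smul, coe_smul, dist_eq_norm, ← map_sub, norm_σ,
      div_sub_div _ _ (denom_ne_zero g z) (denom_ne_zero g w), norm_div, norm_mul, dist_eq_norm]
    congr 1
    have : num g z * denom g w - denom g z * num g w = (g.det.val : ℂ) * (z - w) := by
      simp only [num, denom, Matrix.GeneralLinearGroup.val_det_apply, g.1.det_fin_two]
      push_cast
      ring
    rw [this, norm_mul, Complex.norm_real, Real.norm_eq_abs]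
  have hz := normSq_denom_pos g z.im_ne_zero
  have hw := normSq_denom_pos g w.im_ne_zero
  have hd : 0 < |g.det.val| := abs_pos.2 g.det.ne_zero
  have key : Real.cosh (dist (g • z) (g • w)) = Real.cosh (dist z w) := by
    rw [cosh_dist, cosh_dist, h, im_smul_eq_div_normSq, im_smul_eq_div_normSq]
    have := z.im_pos
    have := w.im_pos
    rw [Complex.normSq_eq_norm_sq] at *
    rw [Complex.normSq_eq_norm_sq]
    have hz' : 0 < ‖denom g z‖ := by simp
    have hw' : 0 < ‖denom g w‖ := by simp
    field_simp
  have := congrArg Real.arcosh key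
  rwa [Real.arcosh_cosh dist_nonneg, Real.arcosh_cosh dist_nonneg] at this

instance : IsIsometricSMul PGL(2, ℝ) ℍ where
  isometry_smul g := by
    obtain ⟨g, rfl⟩ := Matrix.ProjGenLinGroup.mk_surjective g
    exact Isometry.of_dist_eq fun z w => by simpa using dist_gl_smul g z w

instance : SMulInvariantMeasure PGL(2, ℝ) ℍ volume where
  measure_preimage_smul g s hs := by
    obtain ⟨g, rfl⟩ := Matrix.ProjGenLinGroup.mk_surjective g
    simp

theorem lintegral_Ici_inv_sq {a : ℝ} (ha : 0 < a) :
    ∫⁻ y in Set.Ici a, ENNReal.ofReal (1 / y ^ 2) = ENNReal.ofReal (1 / a) := by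
  rw [setLIntegral_congr Ioi_ae_eq_Ici.symm]
  have h2 : ∀ y ∈ Set.Ioi a, y ^ (-2 : ℝ) = 1 / y ^ 2 := by
    intro y hy
    rw [Real.rpow_neg (ha.trans hy).le]
    norm_num
  have hint := integrableOn_Ioi_rpow_of_lt (by norm_num : (-2 : ℝ) < -1) ha
  rw [← setLIntegral_congr_fun measurableSet_Ioi (f := fun y => ENNReal.ofReal (y ^ (-2 : ℝ)))
    (fun y hy => by simp only [h2 y hy]), ← ofReal_integral_eq_lintegral_ofReal hint]
  · rw [integral_Ioi_rpow_of_lt (by norm_num) ha]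
    norm_num
    rw [Real.rpow_neg_one]
  · exact (ae_restrict_iff' measurableSet_Ioi).2
      (Filter.Eventually.of_forall fun y hy => (Real.rpow_nonneg (ha.trans hy).le _))

theorem volume_re_im_mem {A Y : Set ℝ} (hY0 : Y ⊆ Set.Ioi 0) :
    volume {z : ℍ | z.re ∈ A ∧ z.im ∈ Y} = volume A * ∫⁻ y in Y, ENNReal.ofReal (1 / y ^ 2) := by
  have himg : (↑) '' {z : ℍ | z.re ∈ A ∧ z.im ∈ Y} = Complex.measurableEquivRealProd ⁻¹' (A ×ˢ Y) := by
    ext z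
    constructor
    · rintro ⟨w, hw, rfl⟩
      exact hw
    · rintro ⟨h1, h2⟩
      exact ⟨⟨z, hY0 h2⟩, ⟨h1, h2⟩, rfl⟩
  rw [volume_eq_lintegral, himg]
  have hf : ∀ z : ℂ, (((1 / ‖z.im‖₊) ^ 2 : NNReal) : ℝ≥0∞) =
      (fun p : ℝ × ℝ => ENNReal.ofReal (1 / p.2 ^ 2)) (Complex.measurableEquivRealProd z) := by
    intro z
    rw [Complex.measurableEquivRealProd_apply]
    change _ = ENNReal.ofReal (1 / z.im ^ 2)
    rw [ENNReal.ofReal_eq_coe_nnreal (by positivity)]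
    congr 1
    ext
    simp
  simp_rw [hf]
  rw [Complex.volume_preserving_equiv_real_prod.setLIntegral_comp_preimage_emb
    Complex.measurableEquivRealProd.measurableEmbedding
    (fun p : ℝ × ℝ => ENNReal.ofReal (1 / p.2 ^ 2)), Measure.volume_eq_prod,
    setLIntegral_prod _ (by fun_prop)]
  simp [mul_comm]

theorem volume_re_mem_le_im {A : Set ℝ} {a : ℝ} (ha : 0 < a) :
    volume {z : ℍ | z.re ∈ A ∧ a ≤ z.im} = volume A * ENNReal.ofReal (1 / a) := by
  rw [← lintegral_Ici_inv_sq ha]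
  exact volume_re_im_mem fun y hy => ha.trans_le hy

theorem volume_re_mem_lt_im {A : Set ℝ} {a : ℝ} (ha : 0 < a) :
    volume {z : ℍ | z.re ∈ A ∧ a < z.im} = volume A * ENNReal.ofReal (1 / a) := by
  rw [← lintegral_Ici_inv_sq ha, ← setLIntegral_congr Ioi_ae_eq_Ici]
  exact volume_re_im_mem fun y hy => ha.trans hy

/-! ### Vertical shadows: area against length -/

/-- The points of `ℍ` that lie vertically above a point of `F`. -/
def shadow (F : Set ℍ) : Set ℍ := {z | ∃ w ∈ F, w.re = z.re ∧ w.im ≤ z.im}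

theorem shadow_mono {E F : Set ℍ} (h : E ⊆ F) : shadow E ⊆ shadow F :=
  fun _ ⟨w, hw, h'⟩ => ⟨w, h hw, h'⟩

theorem shadow_iUnion {ι : Sort*} (F : ι → Set ℍ) : shadow (⋃ i, F i) = ⋃ i, shadow (F i) := by
  ext z
  simp only [shadow, Set.mem_iUnion, Set.mem_ofPred_eq]
  exact ⟨fun ⟨w, ⟨i, hi⟩, h⟩ => ⟨i, w, hi, h⟩, fun ⟨i, w, hi, h⟩ => ⟨w, ⟨i, hi⟩, h⟩⟩

/-- The area of the shadow, as an outer measure. -/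
noncomputable def shadowMeasure : OuterMeasure ℍ where
  measureOf F := volume (shadow F)
  empty := by simp [shadow]
  mono h := measure_mono (shadow_mono h)
  iUnion_nat F _ := by
    rw [shadow_iUnion]
    exact measure_iUnion_le _

/-- If `w₀ ∈ F`, heights on `F` stay within a factor `e ^ δ` of `w₀.im`. The width is then at most
`w₀.im * e ^ (2δ)` times the diameter, and dividing by the lowest height `w₀.im * e ^ (-δ)` gives
the third factor `e ^ δ`. -/
theorem volume_shadow_le_of_ediam_le {F : Set ℍ} {δ : ℝ} (hδ : 0 < δ)
    (hF : Metric.ediam F ≤ ENNReal.ofReal δ) :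
    volume (shadow F) ≤ ENNReal.ofReal (Real.exp (3 * δ)) * Metric.ediam F := by
  rcases F.eq_empty_or_nonempty with rfl | ⟨w₀, hw₀⟩
  · simp [shadow]
  have hfin : Metric.ediam F ≠ ⊤ := ne_top_of_le_ne_top ENNReal.ofReal_ne_top hF
  set d := Metric.diam F
  have hd : Metric.ediam F = ENNReal.ofReal d := (ENNReal.ofReal_toReal hfin).symm
  have hd0 : 0 ≤ d := Metric.diam_nonneg
  have hdδ : d ≤ δ := ENNReal.toReal_le_of_le_ofReal hδ.le hF
  have hdist : ∀ z ∈ F, ∀ w ∈ F, dist z w ≤ d := fun z hz w hw =>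
    Metric.dist_le_diam_of_mem (Metric.isBounded_iff_ediam_ne_top.2 hfin) hz hw
  have him : ∀ z ∈ F, z.im ≤ w₀.im * Real.exp δ := fun z hz =>
    (im_le_im_mul_exp_dist z w₀).trans (mul_le_mul_of_nonneg_left
      (Real.exp_le_exp.2 ((hdist z hz w₀ hw₀).trans hdδ)) w₀.im_pos.le)
  have him' : ∀ z ∈ F, w₀.im * Real.exp (-δ) ≤ z.im := fun z hz => by
    rw [Real.exp_neg, ← div_eq_mul_inv, div_le_iff₀ (Real.exp_pos _)]
    exact (im_le_im_mul_exp_dist w₀ z).trans (mul_le_mul_of_nonneg_left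
      (Real.exp_le_exp.2 ((hdist w₀ hw₀ z hz).trans hdδ)) z.im_pos.le)
  set L := w₀.im * Real.exp δ * (Real.exp δ * d)
  have hre : ∀ z ∈ F, ∀ w ∈ F, |z.re - w.re| ≤ L := by
    intro z hz w hw
    have h1 : |z.re - w.re| ≤ dist (z : ℂ) w := by
      rw [dist_eq_norm]
      exact Complex.abs_re_le_norm ((z : ℂ) - w)
    refine h1.trans ((dist_coe_le z w).trans ?_)
    have h2 : Real.exp (dist z w) - 1 ≤ Real.exp δ * d := by
      have h3 : Real.exp (dist z w) ≤ Real.exp d := Real.exp_le_exp.2 (hdist z hz w hw)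
      have h4 : Real.exp d * (1 - d) ≤ 1 := by
        have := mul_le_mul_of_nonneg_left (Real.one_sub_le_exp_neg d) (Real.exp_pos d).le
        rwa [← Real.exp_add, add_neg_cancel, Real.exp_zero] at this
      have h5 : Real.exp d * d ≤ Real.exp δ * d :=
        mul_le_mul_of_nonneg_right (Real.exp_le_exp.2 hdδ) hd0
      linarith
    exact mul_le_mul (him w hw) h2 (by simp [dist_nonneg])
      (mul_nonneg w₀.im_pos.le (Real.exp_pos _).le)
  set A : Set ℝ := closure (UpperHalfPlane.re '' F)
  have hA : volume A ≤ ENNReal.ofReal L := by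
    refine (Real.volume_le_diam _).trans ?_
    rw [Metric.ediam_closure]
    refine Metric.ediam_le ?_
    rintro _ ⟨z, hz, rfl⟩ _ ⟨w, hw, rfl⟩
    rw [edist_dist]
    exact ENNReal.ofReal_le_ofReal (hre z hz w hw)
  have ha : 0 < w₀.im * Real.exp (-δ) := mul_pos w₀.im_pos (Real.exp_pos _)
  calc volume (shadow F) ≤ volume {z : ℍ | z.re ∈ A ∧ w₀.im * Real.exp (-δ) ≤ z.im} := by
        refine measure_mono ?_
        rintro z ⟨w, hw, h1, h2⟩
        exact ⟨subset_closure ⟨w, hw, h1⟩, (him' w hw).trans h2⟩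
    _ = volume A * ENNReal.ofReal (1 / (w₀.im * Real.exp (-δ))) :=
        volume_re_mem_le_im ha
    _ ≤ ENNReal.ofReal L * ENNReal.ofReal (1 / (w₀.im * Real.exp (-δ))) := by gcongr
    _ = ENNReal.ofReal (Real.exp (3 * δ)) * Metric.ediam F := by
        rw [hd, ← ENNReal.ofReal_mul (by positivity), ← ENNReal.ofReal_mul (by positivity)]
        congr 1
        have h3 : Real.exp (3 * δ) = Real.exp δ * Real.exp δ * Real.exp δ := by
          rw [← Real.exp_add, ← Real.exp_add]
          ring_nf
        have := w₀.im_ne_zero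
        rw [h3, Real.exp_neg]
        simp only [L]
        field_simp

/-- The area of the shadow of a set is at most the length of the set. -/
theorem volume_shadow_le (F : Set ℍ) : volume (shadow F) ≤ Measure.hausdorffMeasure 1 F := by
  have key : ∀ δ : ℝ, 0 < δ →
      volume (shadow F) ≤ ENNReal.ofReal (Real.exp (3 * δ)) * Measure.hausdorffMeasure 1 F := by
    intro δ hδ
    have hc : ENNReal.ofReal (Real.exp (3 * δ)) ≠ 0 := by simp [Real.exp_pos]
    -- An outer measure bounded by a multiple of the diameter on all small sets is bounded by that
    -- multiple of Hausdorff measure; the constant tends to `1` as `δ → 0`.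
    have h := OuterMeasure.le_mkMetric (ENNReal.ofReal (Real.exp (3 * δ)) • fun r => r ^ (1 : ℝ))
      shadowMeasure (ENNReal.ofReal δ) (by simpa using hδ)
      (fun s hs => by simpa using! volume_shadow_le_of_ediam_le hδ hs)
    rw [OuterMeasure.mkMetric_smul _ ENNReal.ofReal_ne_top hc] at h
    have h' := h F
    rw [smul_apply, OuterMeasure.coe_mkMetric] at h'
    exact h'
  have hlim : Filter.Tendsto
      (fun δ : ℝ => ENNReal.ofReal (Real.exp (3 * δ)) * Measure.hausdorffMeasure 1 F)
      (nhdsWithin 0 (Set.Ioi 0)) (nhds (ENNReal.ofReal (Real.exp (3 * 0)) *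
        Measure.hausdorffMeasure 1 F)) := by
    refine ENNReal.Tendsto.mul_const ?_ (Or.inl (by simp))
    exact Filter.Tendsto.mono_left (Continuous.tendsto
      (ENNReal.continuous_ofReal.comp (by fun_prop)) 0) nhdsWithin_le_nhds
  have := ge_of_tendsto hlim (Filter.eventually_of_mem self_mem_nhdsWithin key)
  simpa using this

theorem hausdorffMeasure_horizontal_le {A : Set ℝ} {s : ℝ} (hs : 0 < s) :
    Measure.hausdorffMeasure 1 {z : ℍ | z.re ∈ A ∧ z.im = s} ≤ volume A * ENNReal.ofReal (1 / s) := by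
  set f : ℝ → ℍ := fun x => ⟨⟨x, s⟩, hs⟩
  have hf : LipschitzWith (Real.toNNReal (1 / s)) f := by
    refine LipschitzWith.of_dist_le_mul fun x y => ?_
    refine (dist_le_dist_coe_div_sqrt _ _).trans (le_of_eq ?_)
    have h1 : ((f x).im * (f y).im) = s * s := rfl
    rw [h1, Real.sqrt_mul_self hs.le, Real.coe_toNNReal _ (by positivity)]
    have h2 : dist (f x : ℂ) (f y) = dist x y := by
      have : ((f x : ℂ) - f y) = ((x - y : ℝ) : ℂ) := by
        apply Complex.ext <;> simp [f]
      rw [dist_eq_norm, this, Complex.norm_real, dist_eq_norm]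
    rw [h2]
    ring
  have himg : {z : ℍ | z.re ∈ A ∧ z.im = s} = f '' A := by
    ext z
    constructor
    · rintro ⟨h1, h2⟩
      exact ⟨z.re, h1, by ext1; exact Complex.ext rfl h2.symm⟩
    · rintro ⟨x, hx, rfl⟩
      exact ⟨hx, rfl⟩
  rw [himg]
  have := (hf.lipschitzOnWith (s := A)).hausdorffMeasure_image_le (d := 1) zero_le_one
  rw [hausdorffMeasure_real] at this
  simpa [mul_comm, ENNReal.ofReal] using this

end UpperHalfPlane

namespace UpperHalfPlane

/-! ### Isometries and the horocycle at height one -/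

/-- An isometry of `ℍ` that acts as a horizontal translation. -/
def IsTranslation (h : PGL(2, ℝ)) : Prop := ∃ b : ℝ, ∀ z : ℍ, h • z = b +ᵥ z

theorem IsTranslation.im_smul {h : PGL(2, ℝ)} (hh : IsTranslation h) (z : ℍ) :
    (h • z).im = z.im := by
  obtain ⟨b, hb⟩ := hh
  rw [hb, vadd_im]

theorem exists_pgl_im_smul (h : PGL(2, ℝ)) : ∃ c d D : ℝ, 0 < D ∧
    (∀ z : ℍ, 0 < (c * z.re + d) ^ 2 + (c * z.im) ^ 2) ∧
    ∀ z : ℍ, (h • z).im = D * z.im / ((c * z.re + d) ^ 2 + (c * z.im) ^ 2) := by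
  obtain ⟨g, rfl⟩ := Matrix.ProjGenLinGroup.mk_surjective h
  have key : ∀ z : ℍ, Complex.normSq (denom g z) =
      (g 1 0 * z.re + g 1 1) ^ 2 + (g 1 0 * z.im) ^ 2 := by
    intro z
    simp only [denom, Complex.normSq_apply, Complex.add_re, Complex.mul_re, Complex.ofReal_re,
      Complex.ofReal_im, Complex.add_im, Complex.mul_im, coe_re, coe_im]
    ring
  refine ⟨g 1 0, g 1 1, |g.det.val|, abs_pos.2 g.det.ne_zero, fun z => ?_, fun z => ?_⟩
  · rw [← key]
    exact normSq_denom_pos g z.im_ne_zero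
  · rw [pglMk_smul, im_smul_eq_div_normSq, key]

/-- The point of `ℍ` with given real and imaginary parts. -/
def pt (x y : ℝ) (hy : 0 < y) : ℍ := ⟨⟨x, y⟩, hy⟩

@[simp] theorem pt_re (x y : ℝ) (hy : 0 < y) : (pt x y hy).re = x := rfl

@[simp] theorem pt_im (x y : ℝ) (hy : 0 < y) : (pt x y hy).im = y := rfl

theorem isTranslation_or_exists_fixed {h : PGL(2, ℝ)} (him : ∀ z : ℍ, (h • z).im = z.im) :
    IsTranslation h ∨ ∃ z : ℍ, h • z = z := by
  obtain ⟨g, rfl⟩ := Matrix.ProjGenLinGroup.mk_surjective h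
  simp only [pglMk_smul] at him
  set a := g 0 0
  set b := g 0 1
  set c := g 1 0
  set d := g 1 1
  have key : ∀ x y : ℝ, 0 < y → |g.det.val| = (c * x + d) ^ 2 + (c * y) ^ 2 := by
    intro x y hy
    have h1 := him (pt x y hy)
    have h2 := normSq_denom_pos g (pt x y hy).im_ne_zero
    rw [im_smul_eq_div_normSq, div_eq_iff h2.ne', mul_comm, pt_im] at h1
    have h3 := mul_left_cancel₀ hy.ne' h1
    rw [h3]
    simp only [denom, Complex.normSq_apply, Complex.add_re, Complex.mul_re, Complex.ofReal_re,
      Complex.ofReal_im, Complex.add_im, Complex.mul_im, coe_re, coe_im, pt_re, pt_im]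
    ring
  have hc : c = 0 := by
    have h1 := key 0 1 one_pos
    have h2 := key 0 2 two_pos
    nlinarith
  have hdet : g.det.val = a * d := by
    rw [Matrix.GeneralLinearGroup.val_det_apply, g.1.det_fin_two]
    change a * d - b * c = a * d
    rw [hc]
    ring
  have hd : d ≠ 0 := by
    intro hd
    exact g.det.ne_zero (by rw [hdet, hd, mul_zero])
  have had : |a| = |d| := by
    have h1 := key 0 1 one_pos
    rw [hdet, hc, abs_mul] at h1
    have : |a| * |d| = |d| * |d| := by
      rw [h1, abs_mul_abs_self]
      ring
    exact mul_right_cancel₀ (abs_ne_zero.2 hd) this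
  have hre : ∀ z : ℍ, (g • z).re = (a * z.re + b) / d := by
    intro z
    rw [re_smul]
    have : num g z / denom g z = ((a * z + b : ℂ)) / (d : ℝ) := by
      simp only [num, denom]
      change (a * z + b : ℂ) / (c * z + d) = _
      rw [hc]
      simp
    rw [this, Complex.div_ofReal_re]
    simp
  rcases abs_eq_abs.1 had with h1 | h1
  · refine Or.inl ⟨b / d, fun z => ext_re_im ?_ ?_⟩
    · rw [pglMk_smul, hre, vadd_re, h1]
      field_simp
      ring
    · rw [pglMk_smul, him, vadd_im]
  -- Here `a = -d`: the map is the reflection `x ↦ b / d - x`, which fixes a vertical line.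
  · refine Or.inr ⟨pt (b / (2 * d)) 1 one_pos, ext_re_im ?_ ?_⟩
    · rw [pglMk_smul, hre, pt_re, h1]
      field_simp
      ring
    · rw [pglMk_smul, him]

theorem im_smul_eq_im_of_horoball {h : PGL(2, ℝ)} (h1 : ∀ z : ℍ, 1 < z.im → 1 ≤ (h • z).im)
    (h2 : ∀ z : ℍ, 1 < (h • z).im → 1 ≤ z.im) (z : ℍ) : (h • z).im = z.im := by
  obtain ⟨c, d, D, hD, hpos, him⟩ := exists_pgl_im_smul h
  have hc : c = 0 := by
    by_contra hc
    have hc2 : 0 < c ^ 2 := by positivity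
    -- Above the pole `-d / c`, height `y` goes to `D / (c ^ 2 * y)`, which is below `1` once `y > D
    -- / c ^ 2`.
    have hy : 0 < D / c ^ 2 := by positivity
    have h3 := h1 (pt (-d / c) (D / c ^ 2 + 2) (by linarith)) (by rw [pt_im]; linarith)
    rw [him, le_div_iff₀ (hpos _), pt_re, pt_im] at h3
    have h4 : c * (-d / c) + d = 0 := by field_simp; ring
    rw [h4] at h3
    have h5 : D = c ^ 2 * (D / c ^ 2) := by field_simp
    set y := D / c ^ 2
    rw [h5] at h3
    nlinarith
  subst hc
  have hd : 0 < d ^ 2 := by simpa using hpos z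
  set k := D / d ^ 2
  have hk : 0 < k := by positivity
  have him' : ∀ z : ℍ, (h • z).im = k * z.im := by
    intro z
    rw [him]
    simp only [k]
    field_simp
    ring
  have hk1 : k = 1 := by
    -- The height halfway between `1` and `1 / k` and its image `(k + 1) / 2` lie on opposite sides
    -- of `1` unless `k = 1`.
    have hy : 0 < (1 + 1 / k) / 2 := by positivity
    have hky : k * ((1 + 1 / k) / 2) = (k + 1) / 2 := by field_simp
    rcases lt_trichotomy k 1 with hlt | heq | hgt
    · have := h1 (pt 0 _ hy) (by
        have : 1 < 1 / k := by rwa [lt_div_iff₀ hk, one_mul]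
        rw [pt_im]; linarith)
      rw [him', pt_im, hky] at this
      linarith
    · exact heq
    · have h3 : 1 / k < 1 := by rwa [div_lt_one hk]
      have := h2 (pt 0 _ hy) (by rw [him', pt_im, hky]; linarith)
      rw [pt_im] at this
      linarith
  rw [him', hk1, one_mul]

/-- For `c ≠ 0` the condition is the quadratic `(c * x + d) ^ 2 = D - c ^ 2`: two distinct
horocycles meet in at most two points. -/
theorem im_smul_eq_im_or_finite (h : PGL(2, ℝ)) :
    (∀ z : ℍ, (h • z).im = z.im) ∨ {z : ℍ | z.im = 1 ∧ (h • z).im = 1}.Finite := by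
  obtain ⟨c, d, D, hD, hpos, him⟩ := exists_pgl_im_smul h
  by_cases hc : c = 0
  · subst hc
    by_cases hd : D = d ^ 2
    · left
      intro z
      have := hpos z
      rw [him, div_eq_iff this.ne', hd]
      ring
    · right
      convert Set.finite_empty
      ext z
      simp only [Set.mem_ofPred_eq, Set.mem_empty_iff_false, iff_false]
      rintro ⟨h1, h2⟩
      rw [him, div_eq_iff (hpos z).ne', h1] at h2
      apply hd
      linarith
  · right
    refine Set.Finite.subset (s := {pt ((√(D - c ^ 2) - d) / c) 1 one_pos,
      pt ((-√(D - c ^ 2) - d) / c) 1 one_pos}) (by simp) ?_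
    rintro z ⟨h1, h2⟩
    rw [him, div_eq_iff (hpos z).ne', h1] at h2
    have h3 : (c * z.re + d) ^ 2 = D - c ^ 2 := by linarith
    have h4 : √(D - c ^ 2) ^ 2 = D - c ^ 2 := Real.sq_sqrt (h3 ▸ sq_nonneg _)
    rcases sq_eq_sq_iff_eq_or_eq_neg.1 (h3.trans h4.symm) with h5 | h5
    · refine Or.inl (ext_re_im ?_ h1)
      rw [pt_re, ← h5]
      field_simp
      ring
    · refine Or.inr (ext_re_im ?_ h1)
      rw [pt_re, ← h5]
      field_simp
      ring

/-! ### The orbit of horoballs at a cusp -/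

/-- The horoball `1 < im z` is moved off itself by each element of `G` other than translations. -/
def HasCuspAtInfty (G : Subgroup PGL(2, ℝ)) : Prop :=
  ∀ h ∈ G, ∀ z : ℍ, 1 < z.im → 1 < (h • z).im → IsTranslation h

theorem dist_pt_exp_one_mul (z : ℍ) :
    dist (pt z.re (Real.exp 1 * z.im) (mul_pos (Real.exp_pos 1) z.im_pos)) z = 1 := by
  rw [dist_of_re_eq (by rfl), pt_im, Real.log_mul (Real.exp_pos 1).ne' z.im_ne_zero, Real.log_exp,
    Real.dist_eq]
  simp

namespace HasCuspAtInfty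

variable {G : Subgroup PGL(2, ℝ)}

/-- Only finitely many of the horoballs in an orbit meet a given compact set. -/
theorem exists_finite (hG : HasCuspAtInfty G) {K : Set ℍ} (hK : IsCompact K) :
    ∃ F : Set PGL(2, ℝ), F.Finite ∧ (∀ f ∈ F, f ∈ G) ∧ ∀ h ∈ G, ∀ w ∈ K, 1 ≤ (h • w).im →
      ∃ f ∈ F, IsTranslation (h * f⁻¹) := by
  classical
  -- Cover the `1`-neighborhood of `K` by finitely many balls of radius `1/2` and pick one `f` per
  -- ball lifting some point of it to height `e`. Climbing distance `1` from `h • w` gives a point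
  -- `c` in such a ball with `h • c` at height at least `e`; then `f • c` is still above `1`, so the
  -- cusp condition applies to `h * f⁻¹`.
  set P : ℍ → PGL(2, ℝ) → Prop := fun x f =>
    f ∈ G ∧ ∃ c ∈ Metric.ball x (1 / 2), Real.exp 1 ≤ (f • c).im
  obtain ⟨t, -, ht, hcov⟩ := hK.cthickening (r := 1).finite_cover_balls (e := 1 / 2) (by norm_num)
  set φ : ℍ → PGL(2, ℝ) := fun x => if hx : ∃ f, P x f then hx.choose else 1
  refine ⟨φ '' t, ht.image φ, ?_, fun h hh w hw him => ?_⟩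
  · rintro _ ⟨x, -, rfl⟩
    by_cases hx : ∃ f, P x f
    · simp only [φ, dif_pos hx]
      exact hx.choose_spec.1
    · simp only [φ, dif_neg hx]
      exact one_mem G
  set u := pt (h • w).re (Real.exp 1 * (h • w).im) (mul_pos (Real.exp_pos 1) (h • w).im_pos)
  have hu : Real.exp 1 ≤ u.im := le_mul_of_one_le_right (Real.exp_pos 1).le him
  set c := h⁻¹ • u
  have hhc : h • c = u := smul_inv_smul h u
  have hcw : dist c w = 1 := by
    rw [← dist_smul h, hhc]
    exact dist_pt_exp_one_mul _
  obtain ⟨x, hxt, hcx⟩ := Set.mem_iUnion₂.1 (hcov (Metric.mem_cthickening_of_dist_le c w 1 K hw hcw.le))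
  have hx : ∃ f, P x f := ⟨h, hh, c, hcx, by rwa [hhc]⟩
  refine ⟨φ x, ⟨x, hxt, rfl⟩, ?_⟩
  have hφ : φ x = hx.choose := dif_pos hx
  obtain ⟨hf, c', hc', him'⟩ := hx.choose_spec
  rw [← hφ] at hf him'
  refine hG _ (mul_mem hh (inv_mem hf)) (φ x • c) ?_ ?_
  · have h1 := im_le_im_mul_exp_dist (φ x • c') (φ x • c)
    rw [dist_smul] at h1
    have h2 : dist c' c < 1 := by
      have := dist_triangle_right c' c x
      rw [Metric.mem_ball] at hcx hc'
      linarith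
    by_contra! h3
    have h4 : (φ x • c).im * Real.exp (dist c' c) ≤ 1 * Real.exp (dist c' c) := by gcongr
    have h5 := Real.exp_lt_exp.2 h2
    linarith
  · rw [mul_smul, inv_smul_smul, hhc]
    have : (1 : ℝ) < Real.exp 1 := by simp
    linarith

theorem im_smul_eq {h f : PGL(2, ℝ)} (hf : IsTranslation (h * f⁻¹)) (z : ℍ) :
    (h • z).im = (f • z).im := by
  have := hf.im_smul (f • z)
  rwa [mul_smul, inv_smul_smul] at this

theorem isClosed (hG : HasCuspAtInfty G) {s : ℝ} (hs : 1 ≤ s) :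
    IsClosed {z : ℍ | ∃ h ∈ G, s ≤ (h • z).im} := by
  rw [← isOpen_compl_iff, isOpen_iff_mem_nhds]
  intro z hz
  obtain ⟨F, hF, hFG, hK⟩ := hG.exists_finite (isCompact_closedBall z 1)
  have h1 : ∀ᶠ w in nhds z, ∀ f ∈ F, (f • w).im < s := by
    refine (Filter.eventually_all_finite hF).2 fun f hf => ?_
    have h2 : (f • z).im < s := by
      by_contra! h3
      exact hz ⟨f, hFG f hf, h3⟩
    exact (continuous_im.comp (continuous_const_smul f)).continuousAt.eventually_lt
      continuousAt_const h2
  filter_upwards [h1, Metric.closedBall_mem_nhds z one_pos] with w hw hwK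
  rintro ⟨h, hh, him⟩
  obtain ⟨f, hf, htr⟩ := hK h hh w hwK (hs.trans him)
  rw [im_smul_eq htr] at him
  exact (hw f hf).not_ge him

theorem isOpen (G : Subgroup PGL(2, ℝ)) (s : ℝ) : IsOpen {z : ℍ | ∃ h ∈ G, s < (h • z).im} := by
  have : {z : ℍ | ∃ h ∈ G, s < (h • z).im} = ⋃ h ∈ G, {z : ℍ | s < (h • z).im} := by
    ext z
    simp
  rw [this]
  exact isOpen_biUnion fun h _ =>
    isOpen_lt continuous_const (continuous_im.comp (continuous_const_smul h))

theorem exists_im_eq_of_mem_frontier (hG : HasCuspAtInfty G) {s : ℝ} (hs : 1 ≤ s) {V : Set ℍ}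
    (hV : {z : ℍ | ∃ h ∈ G, s < (h • z).im} ⊆ V) (hV' : V ⊆ {z : ℍ | ∃ h ∈ G, s ≤ (h • z).im})
    {z : ℍ} (hz : z ∈ frontier V) : ∃ h ∈ G, (h • z).im = s := by
  obtain ⟨h, hh, him⟩ := closure_minimal hV' (hG.isClosed hs) hz.1
  refine ⟨h, hh, him.antisymm' (not_lt.1 fun hlt => hz.2 ?_)⟩
  exact interior_maximal hV (isOpen G s) ⟨h, hh, hlt⟩

theorem frequently_lt_im (z : ℍ) : ∃ᶠ w in nhds z, z.im < w.im := by
  exact Filter.frequently_map.1 ((frequently_gt_nhds z.im).filter_mono (isOpenMap_im.nhds_le z))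

theorem frequently_im_lt (z : ℍ) : ∃ᶠ w in nhds z, w.im < z.im :=
  Filter.frequently_map.1 ((frequently_lt_nhds z.im).filter_mono (isOpenMap_im.nhds_le z))

/-- Otherwise points just above `z` lie in the horoball together with their images, so `h` is a
translation and keeps the height `1`. -/
theorem im_smul_le_one (hG : HasCuspAtInfty G) {h : PGL(2, ℝ)} (hh : h ∈ G) {z : ℍ}
    (hz : z.im = 1) : (h • z).im ≤ 1 := by
  by_contra! h1
  have h2 : ∀ᶠ w in nhds z, 1 < (h • w).im :=
    continuousAt_const.eventually_lt
      (continuous_im.comp (continuous_const_smul h)).continuousAt h1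
  obtain ⟨w, hw, hw'⟩ := ((frequently_lt_im z).and_eventually h2).exists
  have := (hG h hh w (hz ▸ hw) hw').im_smul z
  linarith

/-- Modulo translations only finitely many elements matter near `z`. Each keeps a neighborhood of
`z` below height `1` or preserves heights, so points just below `z` are missed. -/
theorem notMem_interior_closed (hG : HasCuspAtInfty G)
    (hG' : ∀ h ∈ G, ∀ z : ℍ, 1 ≤ z.im → 1 ≤ (h • z).im → IsTranslation h) {z : ℍ}
    (hz : z.im = 1) : z ∉ interior {z : ℍ | ∃ h ∈ G, 1 ≤ (h • z).im} := by
  intro hint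
  obtain ⟨F, hF, hFG, hK⟩ := hG.exists_finite (isCompact_closedBall z 1)
  have h1 : ∀ᶠ w in nhds z, ∀ f ∈ F, (f • w).im < 1 ∨ (f • w).im = w.im := by
    refine (Filter.eventually_all_finite hF).2 fun f hf => ?_
    rcases lt_or_ge (f • z).im 1 with h2 | h2
    · filter_upwards [(continuous_im.comp (continuous_const_smul f)).continuousAt.eventually_lt
        continuousAt_const h2] with w hw using Or.inl hw
    · exact Filter.Eventually.of_forall fun w =>
        Or.inr ((hG' f (hFG f hf) z hz.ge h2).im_smul w)
  obtain ⟨w, ⟨⟨hwz, hw⟩, hwK⟩, h, hh, him⟩ := ((((frequently_im_lt z).and_eventually h1).and_eventually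
    (Metric.closedBall_mem_nhds z one_pos)).and_eventually
    (mem_interior_iff_mem_nhds.1 hint)).exists
  obtain ⟨f, hf, htr⟩ := hK h hh w hwK him
  rw [im_smul_eq htr] at him
  rw [hz] at hwz
  rcases hw f hf with h2 | h2 <;> linarith

/-- Without nonzero translations, finitely many translates of `K` would cover the whole line `im z =
1`, on which `re` is unbounded. -/
theorem exists_vadd_ne_zero (hG : HasCuspAtInfty G) {K : Set ℍ} (hK : IsCompact K)
    (hK' : ∀ z : ℍ, z.im = 1 → ∃ h ∈ G, h • z ∈ K) :
    ∃ h ∈ G, ∃ b : ℝ, b ≠ 0 ∧ ∀ z : ℍ, h • z = b +ᵥ z := by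
  by_contra! hcon
  obtain ⟨F, hF, hFG, hFK⟩ := hG.exists_finite hK
  have hcpt : IsCompact (⋃ f ∈ F, (fun z : ℍ => f • z) '' K) :=
    hF.isCompact_biUnion fun f _ => hK.image (continuous_const_smul f)
  obtain ⟨M, hM⟩ := (hcpt.image continuous_re).bddAbove
  obtain ⟨h, hh, hz⟩ := hK' (pt (M + 1) 1 one_pos) rfl
  set z := pt (M + 1) 1 one_pos
  obtain ⟨f, hf, b, hb⟩ := hFK h⁻¹ (inv_mem hh) (h • z) hz (by rw [inv_smul_smul]; rfl)
  have hb0 : b = 0 := by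
    by_contra hb0
    obtain ⟨w, hw⟩ := hcon _ (mul_mem (inv_mem hh) (inv_mem (hFG f hf))) b hb0
    exact hw (hb w)
  have h1 := hb (f • h • z)
  rw [mul_smul, inv_smul_smul, inv_smul_smul, hb0, zero_vadd] at h1
  have h2 : z.re ≤ M := hM ⟨z, Set.mem_biUnion hf ⟨h • z, hz, h1.symm⟩, rfl⟩
  have h3 : z.re = M + 1 := rfl
  linarith

end HasCuspAtInfty

/-! ### The period of the cusp -/

/-- The lengths of the translations in `G`. -/
def translationLengths (G : Subgroup PGL(2, ℝ)) : AddSubgroup ℝ where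
  carrier := {b | ∃ h ∈ G, ∀ z : ℍ, h • z = b +ᵥ z}
  zero_mem' := ⟨1, one_mem G, fun z => by simp⟩
  add_mem' := by
    rintro a b ⟨h, hh, ha⟩ ⟨k, hk, hb⟩
    exact ⟨h * k, mul_mem hh hk, fun z => by rw [mul_smul, hb, ha, vadd_vadd]⟩
  neg_mem' := by
    rintro a ⟨h, hh, ha⟩
    refine ⟨h⁻¹, inv_mem hh, fun z => ?_⟩
    rw [inv_smul_eq_iff, ha, vadd_vadd, add_neg_cancel, zero_vadd]

theorem exists_period {G : Subgroup PGL(2, ℝ)} (hpd : {h | h ∈ G ∧ dist (h • I) I ≤ 1}.Finite)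
    (hne : ∃ h ∈ G, ∃ b : ℝ, b ≠ 0 ∧ ∀ z : ℍ, h • z = b +ᵥ z) :
    ∃ t : ℝ, 0 < t ∧ translationLengths G = AddSubgroup.zmultiples t := by
  set S : Set ℝ := {b | b ∈ translationLengths G ∧ 0 < b ∧ b < 1}
  have hS : S.Finite := by
    refine (hpd.image fun h => (h • I).re).subset ?_
    rintro b ⟨⟨h, hh, hb⟩, hb0, hb1⟩
    refine ⟨h, ⟨hh, ?_⟩, ?_⟩
    · rw [hb]
      refine (dist_le_dist_coe_div_sqrt _ _).trans ?_
      rw [vadd_im, I_im, mul_one, Real.sqrt_one, div_one, coe_vadd, dist_eq_norm,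
        add_sub_cancel_right, Complex.norm_real, Real.norm_eq_abs, abs_of_pos hb0]
      exact hb1.le
    · simp [hb]
  obtain ⟨ε, hε, hball⟩ := Metric.isOpen_iff.1 hS.isClosed.isOpen_compl 0 (fun h => h.2.1.ne rfl)
  have hdisj : Disjoint (translationLengths G : Set ℝ) (Set.Ioo 0 (min ε 1)) := by
    refine Set.disjoint_left.2 fun b hb hb' => hball (a := b) ?_
      ⟨hb, hb'.1, hb'.2.trans_le (min_le_right _ _)⟩
    rw [Metric.mem_ball, Real.dist_eq, sub_zero, abs_of_pos hb'.1]
    exact hb'.2.trans_le (min_le_left _ _)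
  obtain ⟨t, ht⟩ := AddSubgroup.cyclic_of_isolated_zero (lt_min hε one_pos) hdisj
  rw [← AddSubgroup.zmultiples_eq_closure] at ht
  have ht0 : t ≠ 0 := by
    rintro rfl
    obtain ⟨h, hh, b, hb0, hb⟩ := hne
    have : b ∈ translationLengths G := ⟨h, hh, hb⟩
    rw [ht] at this
    simp [hb0] at this
  refine ⟨|t|, abs_pos.2 ht0, ?_⟩
  rcases abs_choice t with h | h <;> rw [h, ht]
  rw [AddSubgroup.zmultiples_neg]

end UpperHalfPlane

/-! ### Passage to the quotient surface -/

namespace Hyp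

variable {Γ : Subgroup PGL(2, ℝ)} {g : PGL(2, ℝ)}

instance : IsIsometricSMul Γ ℍ := ⟨fun γ => isometry_smul ℍ (γ : PGL(2, ℝ))⟩

instance : SMulInvariantMeasure Γ ℍ volume :=
  ⟨fun γ _ hs => SMulInvariantMeasure.measure_preimage_smul (γ : PGL(2, ℝ)) hs⟩

theorem countable_of_properlyDiscontinuous (Γ : Subgroup PGL(2, ℝ))
    [ProperlyDiscontinuousSMul Γ ℍ] : Countable Γ := by
  have h : (Set.univ : Set Γ) ⊆ ⋃ n, {γ : Γ | ((γ • ·) '' {I} ∩ compactCovering ℍ n).Nonempty} := by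
    intro γ _
    obtain ⟨n, hn⟩ := Set.mem_iUnion.1
      ((iUnion_compactCovering ℍ).symm ▸ Set.mem_univ (γ • I) : γ • I ∈ ⋃ n, compactCovering ℍ n)
    exact Set.mem_iUnion.2 ⟨n, γ • I, ⟨I, rfl, rfl⟩, hn⟩
  exact Set.countable_univ_iff.1 ((Set.countable_iUnion fun n =>
    (ProperlyDiscontinuousSMul.finite_disjoint_inter_image isCompact_singleton
      (isCompact_compactCovering ℍ n)).countable).mono h)

/-- The covering map `ℍ → Γ \ ℍ` in the coordinate that differs from the standard one by `g`. -/
noncomputable def chart (Γ : Subgroup PGL(2, ℝ)) (g : PGL(2, ℝ)) (z : ℍ) : Surface Γ := proj Γ (g • z)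

/-- The deck transformation group of `chart Γ g`. -/
noncomputable def deck (Γ : Subgroup PGL(2, ℝ)) (g : PGL(2, ℝ)) : Subgroup PGL(2, ℝ) :=
  Γ.comap (MulAut.conj g).toMonoidHom

theorem mem_deck {h : PGL(2, ℝ)} : h ∈ deck Γ g ↔ g * h * g⁻¹ ∈ Γ := Iff.rfl

theorem chart_eq_iff {z w : ℍ} : chart Γ g z = chart Γ g w ↔ ∃ h ∈ deck Γ g, h • w = z := by
  unfold chart
  rw [proj_eq_iff]
  constructor
  · rintro ⟨γ, hγ, h⟩
    refine ⟨g⁻¹ * γ * g, ?_, ?_⟩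
    · rw [mem_deck]
      convert hγ using 1
      group
    · rw [mul_smul, mul_smul, h, inv_smul_smul]
  · rintro ⟨h, hh, rfl⟩
    exact ⟨g * h * g⁻¹, hh, by rw [mul_smul, mul_smul, inv_smul_smul]⟩

theorem chart_smul {h : PGL(2, ℝ)} (hh : h ∈ deck Γ g) (z : ℍ) :
    chart Γ g (h • z) = chart Γ g z := chart_eq_iff.2 ⟨h, hh, rfl⟩

theorem continuous_chart : Continuous (chart Γ g) :=
  continuous_quot_mk.comp (continuous_const_smul g)

theorem isOpenMap_chart : IsOpenMap (chart Γ g) :=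
  (isOpenMap_quotient_mk'_mul (Γ := Γ) (T := ℍ)).comp (isOpenMap_smul g)

theorem chart_surjective : Function.Surjective (chart Γ g) := by
  intro x
  obtain ⟨z, rfl⟩ := Quotient.exists_rep x
  exact ⟨g⁻¹ • z, by rw [chart, smul_inv_smul]; rfl⟩

theorem preimage_chart_frontier (A : Set (Surface Γ)) :
    chart Γ g ⁻¹' frontier A = frontier (chart Γ g ⁻¹' A) :=
  isOpenMap_chart.preimage_frontier_eq_frontier_preimage continuous_chart A

theorem preimage_chart_image (H : Set ℍ) :
    chart Γ g ⁻¹' (chart Γ g '' H) = {z | ∃ h ∈ deck Γ g, h • z ∈ H} := by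
  ext z
  constructor
  · rintro ⟨w, hw, hwz⟩
    obtain ⟨h, hh, rfl⟩ := chart_eq_iff.1 hwz
    exact ⟨h, hh, hw⟩
  · rintro ⟨h, hh, hz⟩
    exact ⟨h • z, hz, chart_smul hh z⟩

theorem chart_image (E : Set ℍ) : chart Γ g '' E = proj Γ '' (g • E) := by
  rw [← Set.image_smul, Set.image_image]
  rfl

theorem inter_frontier_nonempty {X : Type*} [TopologicalSpace X] {s V : Set X}
    (hs : IsPreconnected s) (h1 : (s ∩ V).Nonempty) (h2 : (s ∩ Vᶜ).Nonempty) :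
    (s ∩ frontier V).Nonempty := by
  by_contra! hcon
  have hdisj : ∀ x ∈ s, x ∉ frontier V := fun x hx hxV =>
    Set.notMem_empty x (hcon ▸ ⟨hx, hxV⟩)
  obtain ⟨x, hx, hxV⟩ := h1
  obtain ⟨y, hy, hyV⟩ := h2
  obtain ⟨w, -, hw1, hw2⟩ := hs (interior V) (closure V)ᶜ isOpen_interior
    isClosed_closure.isOpen_compl
    (fun w hw => or_iff_not_imp_right.2 fun hwc => by_contra fun hwi =>
      hdisj w hw ⟨not_not.1 hwc, hwi⟩)
    ⟨x, hx, by_contra fun hxi => hdisj x hx ⟨subset_closure hxV, hxi⟩⟩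
    ⟨y, hy, fun hyc => hdisj y hy ⟨hyc, fun hyi => hyV (interior_subset hyi)⟩⟩
  exact hw2 (subset_closure (interior_subset hw1))

section descend

variable {μ : Measure ℍ} [SMulInvariantMeasure PGL(2, ℝ) ℍ μ]

theorem descend_mono (μ : Measure ℍ) {A A' : Set (Surface Γ)} (h : A ⊆ A') :
    descend Γ μ A ≤ descend Γ μ A' :=
  le_iInf₂ fun E hE => iInf₂_le E (h.trans hE)

theorem descend_le_of_subset_chart_image {A : Set (Surface Γ)} {E : Set ℍ}
    (h : A ⊆ chart Γ g '' E) : descend Γ μ A ≤ μ E := by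
  rw [← measure_smul μ g E]
  exact iInf₂_le (f := fun (E : Set ℍ) (_ : A ⊆ proj Γ '' E) => μ E) (g • E)
    (h.trans (chart_image E).subset)

theorem descend_chart_image [Countable Γ] [SMulInvariantMeasure Γ ℍ μ] {U : Set ℍ}
    (hU : MeasurableSet U) (hinj : Set.InjOn (chart Γ g) U) :
    descend Γ μ (chart Γ g '' U) = μ U := by
  rw [chart_image, descend_image (hU.const_smul g), measure_smul]
  rintro _ ⟨z, hz, rfl⟩ _ ⟨w, hw, rfl⟩ h
  exact congrArg _ (hinj hz hw h)

end descend

/-! ### The isoperimetric inequality in the cusp -/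

/-- The points of `im z = 1` at which two horoballs of the orbit touch. -/
def tangencies (G : Subgroup PGL(2, ℝ)) : Set ℍ :=
  {z | z.im = 1 ∧ ∃ h ∈ G, ¬ IsTranslation h ∧ (h • z).im = 1}

/-- Freeness excludes the other height-preserving isometries, the reflections in vertical lines. -/
theorem isTranslation_of_im_smul {G : Subgroup PGL(2, ℝ)}
    (hfree : ∀ h ∈ G, h ≠ 1 → ∀ z : ℍ, h • z ≠ z) {h : PGL(2, ℝ)} (hh : h ∈ G)
    (him : ∀ z : ℍ, (h • z).im = z.im) : IsTranslation h := by
  rcases isTranslation_or_exists_fixed him with h1 | ⟨z, hz⟩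
  · exact h1
  · by_cases h1 : h = 1
    · exact ⟨0, fun z => by simp [h1]⟩
    · exact absurd hz (hfree h hh h1 z)

theorem countable_tangencies {G : Subgroup PGL(2, ℝ)} [Countable G]
    (hfree : ∀ h ∈ G, h ≠ 1 → ∀ z : ℍ, h • z ≠ z) : (tangencies G).Countable := by
  have hsub : tangencies G ⊆ ⋃ h : G, {z : ℍ | ¬ IsTranslation (h : PGL(2, ℝ)) ∧ z.im = 1 ∧
      ((h : PGL(2, ℝ)) • z).im = 1} := by
    rintro z ⟨hz, h, hh, h1, h2⟩
    exact Set.mem_iUnion.2 ⟨⟨h, hh⟩, h1, hz, h2⟩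
  refine (Set.countable_iUnion fun h : G => ?_).mono hsub
  rcases im_smul_eq_im_or_finite h with h1 | h1
  · have := isTranslation_of_im_smul hfree h.2 h1
    simp [this]
  · exact (h1.subset fun z hz => hz.2).countable

/-- `t` is the least translation length of a cusp at infinity of `G`. -/
structure IsCuspPeriod (G : Subgroup PGL(2, ℝ)) (t : ℝ) : Prop where
  cusp : HasCuspAtInfty G
  pos : 0 < t
  lengths : translationLengths G = AddSubgroup.zmultiples t

namespace IsCuspPeriod

theorem exists_re_mem_Ico {G : Subgroup PGL(2, ℝ)} {t : ℝ} (ht : IsCuspPeriod G t) (z : ℍ) :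
    ∃ h ∈ G, (h • z).re ∈ Set.Ico 0 t ∧ (h • z).im = z.im := by
  have hmem : (-toIcoDiv ht.pos 0 z.re) • t ∈ translationLengths G := by
    rw [ht.lengths]
    exact AddSubgroup.zsmul_mem_zmultiples t _
  obtain ⟨h, hh, htr⟩ := hmem
  refine ⟨h, hh, ?_, by rw [htr, vadd_im]⟩
  rw [htr, vadd_re, neg_zsmul, neg_add_eq_sub]
  have := sub_toIcoDiv_zsmul_mem_Ico ht.pos 0 z.re
  rwa [zero_add] at this

variable {t : ℝ}

/-- Off the tangencies only translations identify points at height at least `1`, and a multiple of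
`t` between two points of `[0, t)` is zero. -/
theorem injOn_chart (ht : IsCuspPeriod (deck Γ g) t) :
    Set.InjOn (chart Γ g) ({z | z.re ∈ Set.Ico 0 t ∧ 1 ≤ z.im} \ tangencies (deck Γ g)) := by
  rintro z ⟨⟨hz0, hz1⟩, -⟩ w ⟨⟨hw0, hw1⟩, hw⟩ hzw
  obtain ⟨h, hh, rfl⟩ := chart_eq_iff.1 hzw
  have htr : IsTranslation h := by
    by_contra hcon
    rcases hw1.eq_or_lt with hw2 | hw2
    · have h1 := ht.cusp.im_smul_le_one hh hw2.symm
      exact hw ⟨hw2.symm, h, hh, hcon, le_antisymm h1 hz1⟩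
    · rcases hz1.eq_or_lt with hz2 | hz2
      · have h1 := ht.cusp.im_smul_le_one (inv_mem hh) hz2.symm
        rw [inv_smul_smul] at h1
        exact hw2.not_ge h1
      · exact hcon (ht.cusp h hh w hw2 hz2)
  obtain ⟨b, hb⟩ := htr
  have hmem : b ∈ translationLengths (deck Γ g) := ⟨h, hh, hb⟩
  rw [ht.lengths] at hmem
  obtain ⟨n, rfl⟩ := AddSubgroup.mem_zmultiples_iff.1 hmem
  rw [hb, vadd_re, zsmul_eq_mul] at hz0
  have hpos := ht.pos
  have h1 : (n : ℝ) < 1 := by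
    by_contra! h2
    nlinarith [hz0.2, hw0.1]
  have h2 : (-1 : ℝ) < n := by
    by_contra! h2
    nlinarith [hz0.1, hw0.2]
  have h3 : n < 1 := by exact_mod_cast h1
  have h4 : -1 < n := by exact_mod_cast h2
  have h5 : n = 0 := by omega
  rw [hb, h5, zero_smul, zero_vadd]

theorem measurableSet_re_mem_Ico (t : ℝ) : MeasurableSet {z : ℍ | z.re ∈ Set.Ico 0 t} :=
  continuous_re.measurable measurableSet_Ico

/-- A subset of the cusp has area at most the length of its boundary. -/
theorem area_le_length_frontier [Countable Γ] (ht : IsCuspPeriod (deck Γ g) t)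
    (hT : (tangencies (deck Γ g)).Countable) {D : Set (Surface Γ)}
    (hD : ∀ z, chart Γ g z ∈ D → ∃ h ∈ deck Γ g, 1 ≤ (h • z).im)
    (hD' : ∀ z : ℍ, z.im = 1 → z ∉ interior (chart Γ g ⁻¹' D)) :
    area Γ D ≤ length Γ (frontier D) := by
  set V := chart Γ g ⁻¹' D
  set T := tangencies (deck Γ g)
  set U : Set ℍ := {z | z.re ∈ Set.Ico 0 t ∧ 1 ≤ z.im} ∩ frontier V
  have hcov : D ⊆ chart Γ g '' shadow U := by
    intro x hx
    obtain ⟨z, rfl⟩ := chart_surjective (g := g) x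
    obtain ⟨h, hh, him⟩ := hD z hx
    obtain ⟨k, hk, hre, him'⟩ := ht.exists_re_mem_Ico (h • z)
    set w := k • h • z
    have hwz : chart Γ g w = chart Γ g z := by rw [chart_smul hk, chart_smul hh]
    have hwV : w ∈ V := by
      change chart Γ g w ∈ D
      rwa [hwz]
    have hw1 : 1 ≤ w.im := him' ▸ him
    refine ⟨w, ?_, hwz⟩
    -- Either the foot at height `1` lies in `V`, hence in its frontier as it is not interior, or
    -- the vertical segment leaves `V` and crosses the frontier.
    by_cases h1 : pt w.re 1 one_pos ∈ V
    · exact ⟨pt w.re 1 one_pos, ⟨⟨hre, le_rfl⟩, subset_closure h1, hD' _ rfl⟩, rfl, hw1⟩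
    · set φ : ℝ → ℍ := fun y => pt w.re (max 1 y) (lt_max_of_lt_left one_pos)
      have hφ : Continuous φ := by
        refine Continuous.upperHalfPlaneMk (f := fun y : ℝ => (⟨w.re, max 1 y⟩ : ℂ)) ?_ _
        have : (fun y : ℝ => (⟨w.re, max 1 y⟩ : ℂ)) =
            fun y : ℝ => (w.re : ℂ) + ((max 1 y : ℝ) : ℂ) * Complex.I := by
          funext y
          apply Complex.ext <;> simp
        rw [this]
        fun_prop
      have hpre : IsPreconnected (φ '' Set.Icc 1 w.im) :=
        isPreconnected_Icc.image _ hφ.continuousOn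
      obtain ⟨-, ⟨y, hy, rfl⟩, hyV⟩ := inter_frontier_nonempty hpre (V := V)
        ⟨w, ⟨w.im, ⟨hw1, le_rfl⟩, ext_re_im rfl (max_eq_right hw1)⟩, hwV⟩
        ⟨pt w.re 1 one_pos, ⟨1, ⟨le_rfl, hw1⟩, ext_re_im rfl (max_self 1)⟩, h1⟩
      exact ⟨φ y, ⟨⟨hre, le_max_left _ _⟩, hyV⟩, rfl, max_le hw1 hy.2⟩
  have hUm : MeasurableSet (U \ T) :=
    (((measurableSet_re_mem_Ico t).inter (continuous_im.measurable measurableSet_Ici)).inter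
      isClosed_frontier.measurableSet).diff hT.measurableSet
  have hinj : Set.InjOn (chart Γ g) (U \ T) :=
    ht.injOn_chart.mono (Set.sdiff_subset_sdiff_left Set.inter_subset_left)
  -- Points have length zero, so the countable set `T` and its shadow are negligible.
  have := Measure.nullSingletonClass_hausdorff ℍ one_pos
  calc area Γ D ≤ volume (shadow U) := descend_le_of_subset_chart_image hcov
    _ ≤ shadowMeasure (U \ T ∪ T) := measure_mono (shadow_mono (by simp))
    _ ≤ shadowMeasure (U \ T) + shadowMeasure T := measure_union_le _ _
    _ ≤ Measure.hausdorffMeasure 1 (U \ T) + Measure.hausdorffMeasure 1 T :=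
        add_le_add (volume_shadow_le _) (volume_shadow_le _)
    _ = Measure.hausdorffMeasure 1 (U \ T) := by rw [hT.measure_zero, add_zero]
    _ = length Γ (chart Γ g '' (U \ T)) := (descend_chart_image hUm hinj).symm
    _ ≤ length Γ (frontier D) := by
        refine descend_mono _ ?_
        rintro _ ⟨z, hz, rfl⟩
        have : z ∈ chart Γ g ⁻¹' frontier D := by
          rw [preimage_chart_frontier]
          exact hz.1.2
        exact this

/-! ### Horocusps at height `s` -/

variable {s : ℝ} {W : Set (Surface Γ)}

theorem area_eq [Countable Γ] (ht : IsCuspPeriod (deck Γ g) t) (hs : 1 ≤ s)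
    (hW : chart Γ g '' {z | s < z.im} ⊆ W) (hW' : W ⊆ chart Γ g '' {z | s ≤ z.im}) :
    area Γ W = ENNReal.ofReal (t / s) := by
  have hs0 : 0 < s := one_pos.trans_le hs
  have hval : volume (Set.Ico 0 t) * ENNReal.ofReal (1 / s) = ENNReal.ofReal (t / s) := by
    rw [Real.volume_Ico, sub_zero, ← ENNReal.ofReal_mul ht.pos.le, mul_one_div]
  rw [← hval]
  refine le_antisymm ?_ ?_
  · rw [← volume_re_mem_le_im hs0]
    refine descend_le_of_subset_chart_image (g := g) fun x hx => ?_
    obtain ⟨z, hz, rfl⟩ := hW' hx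
    obtain ⟨h, hh, h1, h2⟩ := ht.exists_re_mem_Ico z
    exact ⟨h • z, ⟨h1, h2 ▸ hz⟩, chart_smul hh z⟩
  · rw [← volume_re_mem_lt_im hs0]
    have hm : MeasurableSet {z : ℍ | z.re ∈ Set.Ico 0 t ∧ s < z.im} :=
      (measurableSet_re_mem_Ico t).inter (continuous_im.measurable measurableSet_Ioi)
    rw [← descend_chart_image (Γ := Γ) (g := g) hm]
    · refine descend_mono _ (Set.Subset.trans ?_ hW)
      exact Set.image_mono fun z hz => hz.2
    · refine ht.injOn_chart.mono ?_
      rintro z ⟨hz1, hz2⟩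
      exact ⟨⟨hz1, (hs.trans_lt hz2).le⟩, fun h => (hs.trans_lt hz2).ne' h.1⟩

theorem exists_im_eq_of_chart_mem_frontier (ht : IsCuspPeriod (deck Γ g) t) (hs : 1 ≤ s)
    (hW : chart Γ g '' {z | s < z.im} ⊆ W) (hW' : W ⊆ chart Γ g '' {z | s ≤ z.im}) {z : ℍ}
    (hz : chart Γ g z ∈ frontier W) : ∃ h ∈ deck Γ g, (h • z).im = s := by
  have hz' : z ∈ chart Γ g ⁻¹' frontier W := hz
  rw [preimage_chart_frontier] at hz'
  refine ht.cusp.exists_im_eq_of_mem_frontier hs ?_ ?_ hz'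
  · exact (preimage_chart_image _).symm.subset.trans (Set.preimage_mono hW)
  · exact (Set.preimage_mono hW').trans (preimage_chart_image _).subset

/-- An upper bound suffices: the reverse inequality follows from area being at most length. -/
theorem length_frontier_le (ht : IsCuspPeriod (deck Γ g) t) (hs : 1 ≤ s)
    (hW : chart Γ g '' {z | s < z.im} ⊆ W) (hW' : W ⊆ chart Γ g '' {z | s ≤ z.im}) :
    length Γ (frontier W) ≤ ENNReal.ofReal (t / s) := by
  have hs0 : 0 < s := one_pos.trans_le hs
  have h1 : length Γ (frontier W) ≤
      Measure.hausdorffMeasure 1 {z : ℍ | z.re ∈ Set.Ico 0 t ∧ z.im = s} := by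
    refine descend_le_of_subset_chart_image (g := g) fun x hx => ?_
    obtain ⟨z, rfl⟩ := chart_surjective (g := g) x
    obtain ⟨h, hh, him⟩ := ht.exists_im_eq_of_chart_mem_frontier hs hW hW' hx
    obtain ⟨k, hk, h1, h2⟩ := ht.exists_re_mem_Ico (h • z)
    exact ⟨k • h • z, ⟨h1, h2.trans him⟩, by rw [chart_smul hk, chart_smul hh]⟩
  refine h1.trans ((hausdorffMeasure_horizontal_le hs0).trans (le_of_eq ?_))
  rw [Real.volume_Ico, sub_zero, ← ENNReal.ofReal_mul ht.pos.le, mul_one_div]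

theorem isoRatio_eq_one [Countable Γ] (ht : IsCuspPeriod (deck Γ g) t) (hs : 1 ≤ s)
    (hW : chart Γ g '' {z | s < z.im} ⊆ W) (hW' : W ⊆ chart Γ g '' {z | s ≤ z.im})
    (hle : area Γ W ≤ length Γ (frontier W)) : isoRatio Γ W = 1 := by
  have ha := ht.area_eq hs hW hW'
  have hl : length Γ (frontier W) = area Γ W :=
    le_antisymm (ha ▸ ht.length_frontier_le hs hW hW') hle
  have hpos : 0 < t / s := div_pos ht.pos (one_pos.trans_le hs)
  rw [isoRatio, hl, ha, ENNReal.div_self (by simpa using hpos) ENNReal.ofReal_ne_top]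

/-- With `s > 1` the boundary stays off height `1`, where horoballs of the orbit may touch; nearby
only translations identify points, so one level set describes the domain. -/
theorem hasSmoothBoundary (ht : IsCuspPeriod (deck Γ g) t) (hs : 1 < s) :
    HasSmoothBoundary Γ (chart Γ g '' {z | s < z.im}) := by
  intro z hz
  have hchart : ∀ w, chart Γ g (g⁻¹ • w) = proj Γ w := fun w => by rw [chart, smul_inv_smul]
  obtain ⟨h, hh, him⟩ := ht.exists_im_eq_of_chart_mem_frontier hs.le subset_rfl
    (Set.image_mono fun z (hz : s < z.im) => hz.le) ((hchart z).symm ▸ hz)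
  rw [← mul_smul] at him
  obtain ⟨c, d, D, hD, hpos, hk⟩ := exists_pgl_im_smul (h * g⁻¹)
  set k := h * g⁻¹
  have hs0 : 0 < s := one_pos.trans hs
  set f : ℂ → ℝ := fun w => s * ((c * w.re + d) ^ 2 + (c * w.im) ^ 2) - D * w.im
  have hlt : ∀ w : ℍ, f w < 0 ↔ s < (k • w).im := fun w => by
    rw [hk, lt_div_iff₀ (hpos w)]
    exact sub_neg
  have hz0 : f z = 0 := by
    have h1 := hk z
    rw [him, eq_div_iff (hpos z).ne'] at h1
    exact sub_eq_zero.2 h1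
  refine ⟨f, ?_, hz0, fun hder => ?_, ?_⟩
  · have h1 : ContDiff ℝ ∞ Complex.re := Complex.reCLM.contDiff
    have h2 : ContDiff ℝ ∞ Complex.im := Complex.imCLM.contDiff
    fun_prop
  · have hre : HasFDerivAt Complex.re Complex.reCLM (z : ℂ) := Complex.reCLM.hasFDerivAt
    have him' : HasFDerivAt Complex.im Complex.imCLM (z : ℂ) := Complex.imCLM.hasFDerivAt
    have hf := (((((hre.const_mul c).add_const d).pow 2).add
      ((him'.const_mul c).pow 2)).const_mul s).sub (him'.const_mul D)
    have hf' := hf.fderiv.symm.trans hder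
    -- If both partial derivatives vanish, then `D = 2 * s * c ^ 2 * y` and `c * x + d = 0`, while
    -- `f z = 0` gives `D * y = s * c ^ 2 * y ^ 2`: a contradiction.
    have hx := congrArg (fun L => L 1) hf'
    have hy := congrArg (fun L => L Complex.I) hf'
    simp at hx hy
    have hc : c ≠ 0 := by
      rintro rfl
      simp [hD.ne'] at hy
    have h1 : c * z.re + d = 0 := by
      rcases hx with h | h | h
      · exact absurd h hs0.ne'
      · linarith
      · exact absurd h hc
    have h2 : s * ((c * z.re + d) ^ 2 + (c * z.im) ^ 2) - D * z.im = 0 := hz0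
    have h3 : D = s * (2 * (c * z.im) * c) := by linarith
    rw [h1, h3] at h2
    have h4 : 0 < s * (c * z.im) ^ 2 := by
      have := z.im_ne_zero
      positivity
    nlinarith
  · have h1 : ∀ᶠ w in nhds z, 1 < (k • w).im :=
      continuousAt_const.eventually_lt
        (continuous_im.comp (continuous_const_smul k)).continuousAt (him.symm ▸ hs)
    filter_upwards [h1] with w hw
    have hkw : chart Γ g (k • w) = proj Γ w := by rw [mul_smul, chart_smul hh, hchart]
    refine ⟨fun hfw => ⟨k • w, (hlt w).1 hfw, hkw⟩, ?_⟩
    rintro ⟨v, hv, hvw⟩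
    rw [← hkw] at hvw
    obtain ⟨h', hh', rfl⟩ := chart_eq_iff.1 hvw
    have := (ht.cusp h' hh' (k • w) hw (hs.trans hv)).im_smul (k • w)
    refine ((hlt w).2 ?_).le
    rw [← this]
    exact hv

end IsCuspPeriod

end Hyp

/-! ### Assembly -/

namespace Hyp

variable {Γ : Subgroup PGL(2, ℝ)} {g : PGL(2, ℝ)}

theorem deck_free (hfree : ∀ γ ∈ Γ, γ ≠ 1 → ∀ z : ℍ, γ • z ≠ z) :
    ∀ h ∈ deck Γ g, h ≠ 1 → ∀ z : ℍ, h • z ≠ z := by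
  intro h hh h1 z hz
  refine hfree _ hh (fun h2 => h1 ?_) (g • z) ?_
  · exact (MulAut.conj g).injective (h2.trans (map_one _).symm)
  · change (g * h * g⁻¹) • g • z = g • z
    rw [mul_smul, mul_smul, inv_smul_smul, hz]

instance [Countable Γ] : Countable (deck Γ g) := by
  refine Function.Injective.countable (β := Γ) (f := fun h => ⟨MulAut.conj g h, h.2⟩) ?_
  intro h k hhk
  exact Subtype.ext ((MulAut.conj g).injective (congrArg Subtype.val hhk))

theorem finite_deck_dist_le [ProperlyDiscontinuousSMul Γ ℍ] :
    {h | h ∈ deck Γ g ∧ dist (h • I) I ≤ 1}.Finite := by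
  have hfin := (ProperlyDiscontinuousSMul.finite_disjoint_inter_image (Γ := Γ)
    (isCompact_singleton (x := g • I)) (isCompact_closedBall (g • I) 1)).image
      fun γ : Γ => (MulAut.conj g).symm (γ : PGL(2, ℝ))
  refine hfin.subset ?_
  rintro h ⟨hh, hdist⟩
  refine ⟨⟨MulAut.conj g h, hh⟩, ⟨(g * h * g⁻¹) • g • I, ⟨g • I, rfl, rfl⟩, ?_⟩,
    (MulAut.conj g).symm_apply_apply h⟩
  rw [Metric.mem_closedBall, mul_smul, mul_smul, inv_smul_smul, dist_smul]
  exact hdist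

/-- Compact sets of the surface are covered by compact sets of `ℍ`. -/
theorem exists_compact_subset_chart_image {A : Set (Surface Γ)} (hA : IsCompact A) :
    ∃ K : Set ℍ, IsCompact K ∧ A ⊆ chart Γ g '' K := by
  obtain ⟨t, ht⟩ := hA.elim_finite_subcover (fun z : ℍ => chart Γ g '' Metric.ball z 1)
    (fun z => isOpenMap_chart _ Metric.isOpen_ball) (fun x _ => by
      obtain ⟨z, rfl⟩ := chart_surjective (g := g) x
      exact Set.mem_iUnion.2 ⟨z, z, Metric.mem_ball_self one_pos, rfl⟩)
  refine ⟨⋃ z ∈ t, Metric.closedBall z 1,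
    t.finite_toSet.isCompact_biUnion fun z _ => isCompact_closedBall z 1, fun x hx => ?_⟩
  obtain ⟨z, hz, w, hw, rfl⟩ := Set.mem_iUnion₂.1 (ht hx)
  exact ⟨w, Set.mem_biUnion hz (Metric.ball_subset_closedBall hw), rfl⟩

/-- An element that does not move `H` off itself preserves it, hence preserves heights. -/
theorem isTranslation_of_isCoveredBy (hfree : ∀ γ ∈ Γ, γ ≠ 1 → ∀ z : ℍ, γ • z ≠ z)
    {H : Set ℍ} (hH : {z : ℍ | 1 < z.im} ⊆ H) (hH' : H ⊆ {z : ℍ | 1 ≤ z.im})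
    (hinv : ∀ γ ∈ Γ, (((fun z => γ • z) '' ((fun z => g • z) '' H)) ∩
      ((fun z => g • z) '' H)).Nonempty →
      (fun z => γ • z) '' ((fun z => g • z) '' H) = (fun z => g • z) '' H)
    {h : PGL(2, ℝ)} (hh : h ∈ deck Γ g) {z : ℍ} (hz : z ∈ H) (hhz : h • z ∈ H) :
    IsTranslation h := by
  have heq := hinv (g * h * g⁻¹) hh ⟨g • h • z, ⟨g • z, ⟨z, hz, rfl⟩, by
    simp only [mul_smul, inv_smul_smul]⟩, ⟨h • z, hhz, rfl⟩⟩
  rw [Set.image_image] at heq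
  simp only [mul_smul, inv_smul_smul] at heq
  have hiff : ∀ w, h • w ∈ H ↔ w ∈ H := by
    intro w
    constructor
    · intro hw
      obtain ⟨v, hv, hvw⟩ := heq.symm.subset ⟨h • w, hw, rfl⟩
      have : v = w := by simpa using hvw
      rwa [← this]
    · intro hw
      obtain ⟨v, hv, hvw⟩ := heq.subset ⟨w, hw, rfl⟩
      have : v = h • w := by simpa using hvw
      rwa [← this]
  exact isTranslation_of_im_smul (deck_free hfree) hh (im_smul_eq_im_of_horoball
    (fun w hw => hH' ((hiff w).2 (hH hw))) (fun w hw => hH' ((hiff w).1 (hH hw))))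

theorem isoConst_eq_one_and_isoRatio_eq_one [ProperlyDiscontinuousSMul Γ ℍ]
    (hfree : ∀ γ ∈ Γ, γ ≠ 1 → ∀ z : ℍ, γ • z ≠ z) {H : Set ℍ} {C : Set (Surface Γ)}
    (hH : {z : ℍ | 1 < z.im} ⊆ H) (hH' : H ⊆ {z : ℍ | 1 ≤ z.im}) (hC : chart Γ g '' H = C)
    (hcusp : HasCuspAtInfty (deck Γ g)) (hfr : IsCompact (frontier C))
    (hbd : ∀ z : ℍ, z.im = 1 → z ∉ interior (chart Γ g ⁻¹' C)) :
    isoConst Γ C = 1 ∧ isoRatio Γ C = 1 := by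
  have := countable_of_properlyDiscontinuous Γ
  have hline : ∀ z : ℍ, z.im = 1 → chart Γ g z ∈ frontier C := by
    intro z hz
    have hz' : z ∈ frontier (chart Γ g ⁻¹' C) := by
      refine ⟨?_, hbd z hz⟩
      refine mem_closure_iff_frequently.2 ((HasCuspAtInfty.frequently_lt_im z).mono fun w hw => ?_)
      rw [← hC]
      exact ⟨w, hH (hz ▸ hw), rfl⟩
    rwa [← preimage_chart_frontier] at hz'
  obtain ⟨K, hK, hKC⟩ := exists_compact_subset_chart_image (g := g) hfr
  obtain ⟨t, ht0, ht⟩ := exists_period finite_deck_dist_le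
    (hcusp.exists_vadd_ne_zero hK fun z hz => by
      obtain ⟨w, hw, hwz⟩ := hKC (hline z hz)
      obtain ⟨h, hh, rfl⟩ := chart_eq_iff.1 hwz
      exact ⟨h, hh, hw⟩)
  have hper : IsCuspPeriod (deck Γ g) t := ⟨hcusp, ht0, ht⟩
  have hle : ∀ D ⊆ C, area Γ D ≤ length Γ (frontier D) := fun D hD =>
    hper.area_le_length_frontier (countable_tangencies (deck_free hfree))
      (fun z hz => by
        obtain ⟨w, hw, hwz⟩ := hC ▸ hD hz
        obtain ⟨h, hh, rfl⟩ := chart_eq_iff.1 hwz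
        exact ⟨h, hh, hH' hw⟩)
      (fun z hz hzD => hbd z hz (interior_mono (Set.preimage_mono hD) hzD))
  refine ⟨le_antisymm ?_ ?_, hper.isoRatio_eq_one le_rfl (hC ▸ Set.image_mono hH)
    (hC ▸ Set.image_mono hH') (hle C subset_rfl)⟩
  -- `C` itself may have a boundary touching itself; any height above `1` avoids this.
  · set D := chart Γ g '' {z | 2 < z.im}
    have hsub : D ⊆ chart Γ g '' {z | 2 ≤ z.im} := Set.image_mono fun z (hz : 2 < z.im) => hz.le
    have hDC : D ⊆ C := hC ▸ Set.image_mono fun z (hz : 2 < z.im) => hH (one_lt_two.trans hz)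
    have ha := hper.area_eq one_le_two subset_rfl hsub
    refine iInf_le_of_le D (iInf_le_of_le hDC (iInf_le_of_le
      (hper.hasSmoothBoundary one_lt_two) (iInf_le_of_le ?_ (iInf_le_of_le ?_ ?_))))
    · rw [ha]
      simpa using ht0
    · rw [ha]
      exact ENNReal.ofReal_ne_top
    · exact (hper.isoRatio_eq_one one_le_two subset_rfl hsub (hle D hDC)).le
  · refine le_iInf fun D => le_iInf fun hD => le_iInf fun _ => le_iInf fun h0 => le_iInf fun h1 => ?_
    rw [isoRatio, ENNReal.le_div_iff_mul_le (Or.inl h0) (Or.inl h1), one_mul]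
    exact hle D hD

end Hyp

theorem lemma5p4 (Γ : Subgroup PGL(2, ℝ)) [ProperlyDiscontinuousSMul Γ ℍ]
    (hfree : ∀ γ ∈ Γ, γ ≠ 1 → ∀ z : ℍ, γ • z ≠ z)
    (C : Set (Hyp.Surface Γ)) (hC : Hyp.IsHorocuspNeighborhood Γ C) :
    Hyp.isoConst Γ C = 1 ∧ Hyp.isoRatio Γ C = 1 := by
  obtain ⟨⟨-, hfr, -⟩, B, ⟨g, hB⟩, rfl, hinv⟩ := hC
  rcases hB with rfl | rfl
  · have htr := fun h hh z hz hhz => Hyp.isTranslation_of_isCoveredBy hfree subset_rfl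
      (fun z (hz : 1 < z.im) => hz.le) hinv (h := h) hh (z := z) hz hhz
    have hcusp : HasCuspAtInfty (Hyp.deck Γ g) := htr
    have himg : Hyp.chart Γ g '' {z : ℍ | 1 < z.im} =
        Hyp.proj Γ '' ((fun z => g • z) '' {z : ℍ | 1 < z.im}) := by
      rw [Set.image_image]
      rfl
    refine Hyp.isoConst_eq_one_and_isoRatio_eq_one hfree subset_rfl
      (fun z (hz : 1 < z.im) => hz.le) himg hcusp hfr fun z hz hint => ?_
    rw [← himg, Hyp.preimage_chart_image] at hint
    obtain ⟨h, hh, h1⟩ := interior_subset hint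
    exact (hcusp.im_smul_le_one hh hz).not_gt h1
  · have htr := fun h hh z hz hhz => Hyp.isTranslation_of_isCoveredBy hfree
      (fun z (hz : 1 < z.im) => hz.le) subset_rfl hinv (h := h) hh (z := z) hz hhz
    have hcusp : HasCuspAtInfty (Hyp.deck Γ g) := fun h hh z hz hhz => htr h hh z hz.le hhz.le
    have himg : Hyp.chart Γ g '' {z : ℍ | 1 ≤ z.im} =
        Hyp.proj Γ '' ((fun z => g • z) '' {z : ℍ | 1 ≤ z.im}) := by
      rw [Set.image_image]
      rfl
    refine Hyp.isoConst_eq_one_and_isoRatio_eq_one hfree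
      (fun z (hz : 1 < z.im) => hz.le) subset_rfl himg hcusp hfr fun z hz hint => ?_
    rw [← himg, Hyp.preimage_chart_image] at hint
    exact hcusp.notMem_interior_closed htr hz hint
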